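/- Let $d\ge 1$ and let $(X_A)$ be independent $\{0,1\}$-valued random variables indexed by the finite non-empty subsets $A\Subset\mathbb{Z}^d$. Put $p_A:=\mathbb{P}(X_A=1)$, and assume that $p_A<1$ for all $A$, that $\sum_{A\Subset\mathbb{Z}^d:\,v\in A}p_A<\infty$ for all $v\in\mathbb{Z}^d$, and that $p_{A+v}=p_A$ for all $A\Subset\mathbb{Z}^d$ and $v\in\mathbb{Z}^d$. Let $\bar X=(\bar X_v)_{v\in\mathbb{Z}^d}$ be the $\{0,1\}$-valued process $\bar X_v:=\max\{X_A : A\ni v\}$, i.e. the indicator of the random set $\bigcup\{A : X_A=1\}$. Suppose that $\bar X$ is a finitary factor of an IID process. That is, there are IID random variables $U=(U_v)_{v\in\mathbb{Z}^d}$ with values in some measurable space $S$, and a measurable map $F:S^{\mathbb{Z}^d}\to\{0,1\}^{\mathbb{Z}^d}$, such that: for all $v\in\mathbb{Z}^d$, almost surely $F(U+v)=F(U)+v$, where $(z+v)_x:=z_{x-v}$; $F(U)$ has the same distribution as $\bar X$; and there is an almost surely finite stopping time $R$ with respect to the filtration $\mathcal{F}_n:=\sigma(U_v:\|v\|_\infty\le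 n)$, $n\ge 0$, such that $F(U)_0$ is almost surely equal to an $\mathcal{F}_R$-measurable random variable. Then $$\sum_{A\Subset\mathbb{Z}^d:\,0\in A}p_A\,e^{\lambda|A|}<\infty\qquad\text{for some }\lambda>0 .$$ -/

import Mathlib

open MeasureTheory ProbabilityTheory

universe u w

/-- The finite non-empty subsets of `V`. -/
abbrev FinSets (V : Type*) : Type _ := {A : Finset V // A.Nonempty}

/-- The translate `A + v = {a + v : a ∈ A}` of a finite non-empty set `A`. -/
def FinSets.translate {d : ℕ} (A : FinSets (Fin d → ℤ)) (v : Fin d → ℤ) :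
    FinSets (Fin d → ℤ) :=
  ⟨A.1.map (Equiv.addRight v).toEmbedding, A.2.map⟩

/-- The `{0,1}`-valued process `X̄_v = max {X_A : A ∋ v}`, i.e. the indicator process of the
union of all finite non-empty sets `A` with `X_A = 1`. Here `true` stands for `1`. -/
noncomputable def unionProcess {V Ω : Type*} (X : FinSets V → Ω → Bool) (ω : Ω) : V → Bool :=
  open Classical in fun v => decide (∃ A : FinSets V, v ∈ A.1 ∧ X A ω = true)

/-- The translate `z + v` of a configuration `z` on `ℤ^d`: `(z + v)_x = z_{x - v}`. -/
def shift {d : ℕ} {S : Type*} (v : Fin d → ℤ) (z : (Fin d → ℤ) → S) : (Fin d → ℤ) → S :=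
  fun x => z (x - v)

/-- The filtration `ℱ_n = σ(U_v : ‖v‖ ≤ n)` on the space of configurations `U = (U_v)` on `ℤ^d`
with values in `S` (`‖·‖` is the maximum norm). -/
def boxFiltration (d : ℕ) (S : Type*) [MeasurableSpace S] :
    Filtration ℕ (inferInstance : MeasurableSpace ((Fin d → ℤ) → S)) where
  seq n := ⨆ v : {v : Fin d → ℤ // ‖v‖ ≤ n},
    MeasurableSpace.comap (fun U : (Fin d → ℤ) → S => U v.1) inferInstance
  mono' := by
    intro m n hmn
    refine iSup_le fun v => ?_
    have hv : ‖v.1‖ ≤ (n : ℝ) := v.2.trans (by exact_mod_cast hmn)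
    exact le_iSup (fun v : {v : Fin d → ℤ // ‖v‖ ≤ n} =>
      MeasurableSpace.comap (fun U : (Fin d → ℤ) → S => U v.1) inferInstance) ⟨v.1, hv⟩
  le' := fun _ => iSup_le fun v => (measurable_pi_apply v.1).comap_le

/-- The process `Z = (Z_v)`, indexed by `ℤ^d`, defined on the probability space `(Ω, P)` and with
values in `α`, is a *finitary factor of an IID process*: there are a probability space `(S, μ)`
and a measurable map `F` such that, when `U = (U_v)` is IID with `U_v ∼ μ`, i.e. when `U` has law
the product measure `μ^{ℤ^d}`,
* `F(U + v) = F(U) + v` almost surely, for every `v`;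
* `Z` has the same distribution as `F(U)`;
* there is an almost surely finite stopping time `R` with respect to `ℱ_n = σ(U_v : ‖v‖ ≤ n)`
  (a coding radius) such that `F(U)_0` is, up to a null set, `ℱ_R`-measurable. -/
def IsFinitaryFactorOfIID {d : ℕ} {Ω α : Type*} [MeasurableSpace Ω] [MeasurableSpace α]
    (Z : Ω → (Fin d → ℤ) → α) (P : Measure Ω) : Prop :=
  ∃ (S : Type w) (_ : MeasurableSpace S) (μ : Measure S) (_ : IsProbabilityMeasure μ)
    (F : ((Fin d → ℤ) → S) → ((Fin d → ℤ) → α)),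
    Measurable F ∧
    (∀ v : Fin d → ℤ, ∀ᵐ U ∂(Measure.infinitePi fun _ : Fin d → ℤ => μ),
      F (shift v U) = shift v (F U)) ∧
    IdentDistrib Z F P (Measure.infinitePi fun _ : Fin d → ℤ => μ) ∧
    ∃ (R : ((Fin d → ℤ) → S) → WithTop ℕ) (hR : IsStoppingTime (boxFiltration d S) R),
      (∀ᵐ U ∂(Measure.infinitePi fun _ : Fin d → ℤ => μ), R U ≠ ⊤) ∧
      ∃ g : ((Fin d → ℤ) → S) → α, Measurable[hR.measurableSpace] g ∧
        ∀ᵐ U ∂(Measure.infinitePi fun _ : Fin d → ℤ => μ), F U 0 = g U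

/-! Two estimates for the exponential moment of the number of occupied sites of a sublattice box are
played against each other.

Upper bound (`exists_integral_expCount_le`): the occupation density is below 1, so the coding radius
can be truncated at some `r` while dominating the process by a local function of `U` of density `ρ <
1`. Along `(2r+1)ℤ^d` its values are independent, so the moment over `W` is at most `exp β ^ |W|`
with `β = log (1 + ρ(e - 1)) < 1`.

Lower bound (`exp_le_integral_expCount`): raise `p_A` to `min 1 (K p_A)` for finitely many sets `A`
of size `n`. By convexity of `exp`, this costs at most `log K` per expected set. Let `D_n = sizeSum
p n > 0`. Taking `K = 2L / D_n` covers every site of the sublattice box with probability at least `1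
- exp (-L)`. Since each set has `n` sites, double counting (`card_mul_sum_le`) bounds the expected
number of sets by a constant times `|W| / n`.

Once `1 - exp (-L) > β`, comparing the two (`tilting_inequality`) forces `log K ≥ c n`, that is,
`D_n ≤ 2L exp (-c n)`. Any rate below `c` then gives summability. -/

/-! ### Random subsets of a finite set: exponential tilting. -/

section BernoulliSubset

variable {ι : Type*} [DecidableEq ι]

/-- The expectation of `f T`, where `T` is the random subset of `s` containing each `a ∈ s`
independently with probability `q a`. -/
noncomputable def bernoulliSum (q : ι → ℝ) (s : Finset ι) (f : Finset ι → ℝ) : ℝ :=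
  ∑ T ∈ s.powerset, (∏ a ∈ T, q a) * (∏ a ∈ s \ T, (1 - q a)) * f T

lemma bernoulliSum_empty (q : ι → ℝ) (f : Finset ι → ℝ) : bernoulliSum q ∅ f = f ∅ := by
  simp [bernoulliSum]

lemma bernoulliSum_insert (q : ι → ℝ) {s : Finset ι} {a : ι} (ha : a ∉ s) (f : Finset ι → ℝ) :
    bernoulliSum q (insert a s) f =
      (1 - q a) * bernoulliSum q s f + q a * bernoulliSum q s fun T => f (insert a T) := by
  unfold bernoulliSum
  rw [Finset.sum_powerset_insert ha, Finset.mul_sum, Finset.mul_sum]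
  congr 1
  · refine Finset.sum_congr rfl fun T hT => ?_
    have haT : a ∉ T := fun h => ha (Finset.mem_powerset.1 hT h)
    rw [Finset.insert_sdiff_of_notMem _ haT, Finset.prod_insert (by simp [ha])]
    ring
  · refine Finset.sum_congr rfl fun T hT => ?_
    have haT : a ∉ T := fun h => ha (Finset.mem_powerset.1 hT h)
    rw [Finset.insert_sdiff_insert, Finset.sdiff_insert_of_notMem ha, Finset.prod_insert haT]
    ring

lemma bernoulliSum_const (q : ι → ℝ) (s : Finset ι) (c : ℝ) :
    bernoulliSum q s (fun _ => c) = c := by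
  induction s using Finset.induction_on with
  | empty => exact bernoulliSum_empty q _
  | insert a s ha ih => rw [bernoulliSum_insert q ha, ih]; ring

lemma bernoulliSum_sum {κ : Type*} (q : ι → ℝ) (s : Finset ι) (t : Finset κ)
    (f : κ → Finset ι → ℝ) :
    bernoulliSum q s (fun T => ∑ k ∈ t, f k T) = ∑ k ∈ t, bernoulliSum q s (f k) := by
  simp only [bernoulliSum, Finset.mul_sum]
  rw [Finset.sum_comm]

lemma bernoulliSum_exists (q : ι → ℝ) (s : Finset ι) (Q : ι → Prop) [DecidablePred Q] :
    bernoulliSum q s (fun T => if ∃ a ∈ T, Q a then 1 else 0) =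
      1 - ∏ a ∈ s with Q a, (1 - q a) := by
  induction s using Finset.induction_on with
  | empty => simp [bernoulliSum_empty]
  | insert a s ha ih =>
    rw [bernoulliSum_insert q ha, ih, Finset.filter_insert]
    by_cases hQ : Q a
    · have h1 : bernoulliSum q s (fun T => if ∃ b ∈ insert a T, Q b then (1 : ℝ) else 0) = 1 := by
        simp only [Finset.mem_insert, exists_eq_or_imp, hQ, true_or, if_true, bernoulliSum_const]
      rw [h1, if_pos hQ, Finset.prod_insert (by simp [ha])]
      ring
    · have h1 : bernoulliSum q s (fun T => if ∃ b ∈ insert a T, Q b then (1 : ℝ) else 0) =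
          1 - ∏ a ∈ s with Q a, (1 - q a) := by
        simp only [Finset.mem_insert, exists_eq_or_imp, hQ, false_or]
        exact ih
      rw [h1, if_neg hQ]
      ring

/-- One-coordinate case of the Gibbs variational bound. Convexity of `exp` with weights `1 - q` and
`q` reduces it to comparing weights: `1 - q ≤ 1 - p`, and the factor `exp (-κ)` absorbs the passage
from `p` to `q`. -/
lemma exp_le_bernoulli {p q κ : ℝ} (hq0 : 0 ≤ q) (hpq : p ≤ q) (hq1 : q ≤ 1)
    (hqp : q ≤ Real.exp κ * p) (a b : ℝ) :
    Real.exp ((1 - q) * a + q * (b - κ)) ≤ (1 - p) * Real.exp a + p * Real.exp b := by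
  have hconv := convexOn_exp.2 (Set.mem_univ a) (Set.mem_univ (b - κ))
    (sub_nonneg.2 hq1) hq0 (by ring)
  simp only [smul_eq_mul] at hconv
  refine hconv.trans (add_le_add ?_ ?_)
  · exact mul_le_mul_of_nonneg_right (by linarith) (Real.exp_pos a).le
  · rw [Real.exp_sub, ← mul_div_assoc, div_le_iff₀ (Real.exp_pos κ)]
    nlinarith [mul_le_mul_of_nonneg_right hqp (Real.exp_pos b).le]

/-- Change of measure: increasing the inclusion probabilities by a factor of at most `exp κ` costs
at most `κ` times the expected size of the random subset. -/
lemma exp_bernoulliSum_le {p q : ι → ℝ} {κ : ℝ} {s : Finset ι} (hp0 : ∀ a ∈ s, 0 ≤ p a)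
    (hpq : ∀ a ∈ s, p a ≤ q a) (hq1 : ∀ a ∈ s, q a ≤ 1)
    (hqp : ∀ a ∈ s, q a ≤ Real.exp κ * p a) (f : Finset ι → ℝ) :
    Real.exp (bernoulliSum q s f - κ * ∑ a ∈ s, q a) ≤
      bernoulliSum p s fun T => Real.exp (f T) := by
  induction s using Finset.induction_on generalizing f with
  | empty => simp [bernoulliSum_empty]
  | insert a s ha ih =>
    simp only [Finset.mem_insert, forall_eq_or_imp] at hp0 hpq hq1 hqp
    have ih' := ih hp0.2 hpq.2 hq1.2 hqp.2
    rw [bernoulliSum_insert q ha, bernoulliSum_insert p ha, Finset.sum_insert ha]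
    have h := exp_le_bernoulli (hp0.1.trans hpq.1) hpq.1 hq1.1 hqp.1
      (bernoulliSum q s f - κ * ∑ a ∈ s, q a)
      (bernoulliSum q s (fun T => f (insert a T)) - κ * ∑ a ∈ s, q a)
    refine (le_of_eq ?_).trans (h.trans (add_le_add ?_ ?_))
    · congr 1; ring
    · exact mul_le_mul_of_nonneg_left (ih' f) (by linarith [hpq.1, hq1.1])
    · exact mul_le_mul_of_nonneg_left (ih' _) hp0.1

/-- Partitioning `Ω` by the value of the random subset turns the expectation into a finite sum, and
independence factors each cell. -/
lemma integral_filter_eq_bernoulliSum {Ω : Type*} [MeasurableSpace Ω] {P : Measure Ω}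
    [IsProbabilityMeasure P] {X : ι → Ω → Bool} (hXm : ∀ a, Measurable (X a))
    (hXi : iIndepFun X P) {p : ι → ℝ} (hp : ∀ a, p a = P.real {ω | X a ω = true})
    (s : Finset ι) (f : Finset ι → ℝ) :
    ∫ ω, f (s.filter fun a => X a ω = true) ∂P = bernoulliSum p s f := by
  have hset : ∀ T ∈ s.powerset, {ω | s.filter (fun a => X a ω = true) = T} =
      ⋂ a ∈ s, X a ⁻¹' {decide (a ∈ T)} := by
    intro T hT
    ext ω
    rw [Finset.mem_powerset] at hT
    simp only [Set.mem_ofPred_eq, Set.mem_iInter, Set.mem_preimage, Set.mem_singleton_iff,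
      Finset.ext_iff, Finset.mem_filter]
    constructor
    · intro h a ha
      have := h a
      by_cases haT : a ∈ T <;> simp_all
    · intro h a
      by_cases haT : a ∈ T
      · simp [haT, hT haT, h a (hT haT)]
      · simp only [haT, iff_false, not_and]
        intro ha
        simp [h a ha, haT]
  have hmeas : ∀ T ∈ s.powerset,
      MeasurableSet {ω | s.filter (fun a => X a ω = true) = T} := by
    intro T hT
    rw [hset T hT]
    exact Finset.measurableSet_biInter _ fun a _ => hXm a (measurableSet_singleton _)
  have hfun : ∀ ω, f (s.filter fun a => X a ω = true) =
      ∑ T ∈ s.powerset, {ω | s.filter (fun a => X a ω = true) = T}.indicator (fun _ => f T) ω := by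
    intro ω
    rw [Finset.sum_eq_single (s.filter fun a => X a ω = true)]
    · simp
    · intro T _ hT
      exact Set.indicator_of_notMem (fun h => hT h.symm) _
    · intro h
      exact absurd (Finset.mem_powerset.2 (Finset.filter_subset _ _)) h
  have hfalse : ∀ a, P.real (X a ⁻¹' {false}) = 1 - p a := by
    intro a
    rw [hp]
    change _ = 1 - P.real (X a ⁻¹' {true})
    rw [← probReal_compl_eq_one_sub (hXm a (measurableSet_singleton true))]
    congr 1
    ext ω
    simp
  simp_rw [hfun]
  rw [integral_finsetSum _ fun T hT => (integrable_const _).indicator (hmeas T hT)]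
  refine Finset.sum_congr rfl fun T hT => ?_
  rw [integral_indicator_const _ (hmeas T hT), smul_eq_mul, hset T hT, Measure.real,
    hXi.measure_inter_preimage_eq_mul s (fun a _ => measurableSet_singleton _),
    ENNReal.toReal_prod]
  congr 1
  rw [← Finset.prod_sdiff (Finset.mem_powerset.1 hT), mul_comm]
  congr 1
  · refine Finset.prod_congr rfl fun a ha => ?_
    rw [hp]
    simp only [ha, decide_true]
    rfl
  · refine Finset.prod_congr rfl fun a ha => ?_
    rw [← hfalse]
    simp only [(Finset.mem_sdiff.1 ha).2, decide_false]
    rfl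

end BernoulliSubset

/-! ### The union process: lower bound on exponential moments, and density below 1. -/

section UnionProcess

variable {V Ω : Type*} {X : FinSets V → Ω → Bool}

lemma unionProcess_eq_true_iff {ω : Ω} {v : V} :
    unionProcess X ω v = true ↔ ∃ A : FinSets V, v ∈ A.1 ∧ X A ω = true := by
  simp [unionProcess]

variable [MeasurableSpace Ω]

lemma measurable_unionProcess [Countable V] (hXm : ∀ A, Measurable (X A)) :
    Measurable (unionProcess X) := by
  refine measurable_pi_iff.2 fun v => measurable_to_bool ?_
  have : (fun ω => unionProcess X ω v) ⁻¹' {true} =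
      ⋃ A ∈ {A : FinSets V | v ∈ A.1}, X A ⁻¹' {true} := by
    ext ω
    simp [unionProcess_eq_true_iff]
  rw [this]
  exact MeasurableSet.biUnion (Set.to_countable _) fun A _ => hXm A (measurableSet_singleton _)

/-- The exponential of the number of sites of `s` occupied by the configuration `z`. -/
noncomputable def expCount (s : Finset V) (z : V → Bool) : ℝ :=
  Real.exp (∑ v ∈ s, if z v = true then 1 else 0)

lemma measurable_expCount (s : Finset V) : Measurable (expCount s) := by
  refine Real.measurable_exp.comp (Finset.measurable_sum _ fun v _ => ?_)
  exact Measurable.ite (measurable_pi_apply (X := fun _ : V => Bool) v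
      (measurableSet_singleton true))
    measurable_const measurable_const

lemma expCount_nonneg (s : Finset V) (z : V → Bool) : 0 ≤ expCount s z := (Real.exp_pos _).le

lemma expCount_le (s : Finset V) (z : V → Bool) : expCount s z ≤ Real.exp s.card := by
  refine Real.exp_le_exp.2 ((Finset.sum_le_card_nsmul s _ 1 fun v _ => ?_).trans (by simp))
  split_ifs <;> norm_num

lemma integrable_expCount_comp {P : Measure Ω} [IsFiniteMeasure P] (s : Finset V)
    {Z : Ω → V → Bool} (hZ : AEMeasurable Z P) : Integrable (fun ω => expCount s (Z ω)) P := by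
  refine Integrable.of_bound ((measurable_expCount s).comp_aemeasurable hZ).aestronglyMeasurable
    (Real.exp s.card) (ae_of_all _ fun ω => ?_)
  rw [Real.norm_of_nonneg (expCount_nonneg _ _)]
  exact expCount_le _ _

/-- Lower bound on the exponential moments of the union process, by exponential tilting. -/
lemma exp_le_integral_expCount [Countable V] [DecidableEq V] {P : Measure Ω}
    [IsProbabilityMeasure P] (hXm : ∀ A, Measurable (X A)) (hXi : iIndepFun X P)
    {p q : FinSets V → ℝ} (hp : ∀ A, p A = P.real {ω | X A ω = true}) {κ : ℝ}
    {s : Finset (FinSets V)} (hpq : ∀ A ∈ s, p A ≤ q A) (hq1 : ∀ A ∈ s, q A ≤ 1)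
    (hqp : ∀ A ∈ s, q A ≤ Real.exp κ * p A) (t : Finset V) :
    Real.exp (∑ v ∈ t, (1 - ∏ A ∈ s with v ∈ A.1, (1 - q A)) - κ * ∑ A ∈ s, q A) ≤
      ∫ ω, expCount t (unionProcess X ω) ∂P := by
  set f : Finset (FinSets V) → ℝ := fun T => ∑ v ∈ t, if ∃ A ∈ T, v ∈ A.1 then 1 else 0 with hf
  have hp0 : ∀ A ∈ s, 0 ≤ p A := fun A _ => by rw [hp]; exact measureReal_nonneg
  have h := exp_bernoulliSum_le hp0 hpq hq1 hqp f
  rw [bernoulliSum_sum] at h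
  simp_rw [bernoulliSum_exists] at h
  refine h.trans ?_
  rw [← integral_filter_eq_bernoulliSum hXm hXi hp]
  refine integral_mono_of_nonneg (ae_of_all _ fun ω => (Real.exp_pos _).le)
    (integrable_expCount_comp t (measurable_unionProcess hXm).aemeasurable)
    (ae_of_all _ fun ω => Real.exp_le_exp.2 (Finset.sum_le_sum fun v _ => ?_))
  -- The union over all sets contains the union over `s`, so discarding the sets outside `s` only
  -- lowers the count.
  by_cases hv : unionProcess X ω v = true
  · rw [if_pos hv]; split_ifs <;> norm_num
  · rw [if_neg hv, if_neg]
    rintro ⟨A, hA, hvA⟩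
    exact hv (unionProcess_eq_true_iff.2 ⟨A, hvA, (Finset.mem_filter.1 hA).2⟩)

/-- With positive probability no set containing `v` is present: finitely many sets are absent by
independence and `p_A < 1`, all the others by a union bound, and these two events are independent.
-/
lemma measureReal_unionProcess_lt_one [Countable V] {P : Measure Ω}
    [IsProbabilityMeasure P] (hXm : ∀ A, Measurable (X A)) (hXi : iIndepFun X P)
    (hp1 : ∀ A, P.real {ω | X A ω = true} < 1) (v : V)
    (hsum : Summable fun A : {A : FinSets V // v ∈ A.1} => P.real {ω | X A.1 ω = true}) :
    P.real {ω | unionProcess X ω v = true} < 1 := by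
  classical
  have hfalse : ∀ A, 0 < P (X A ⁻¹' {false}) := by
    intro A
    have h1 := hp1 A
    rw [pos_iff_ne_zero]
    intro h0
    have h2 : P.real (X A ⁻¹' {true})ᶜ = 1 - P.real (X A ⁻¹' {true}) :=
      probReal_compl_eq_one_sub (hXm A (measurableSet_singleton true))
    have h3 : (X A ⁻¹' {true})ᶜ = X A ⁻¹' {false} := by ext ω; simp
    rw [h3, Measure.real, h0] at h2
    have h4 : P.real (X A ⁻¹' {true}) < 1 := h1
    simp only [ENNReal.toReal_zero] at h2
    linarith
  have hsum' : ∑' A : {A : FinSets V // v ∈ A.1}, P (X A.1 ⁻¹' {true}) ≠ ⊤ := by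
    have h := hsum.tsum_ofReal_ne_top
    refine ne_of_eq_of_ne (tsum_congr fun A => ?_) h
    exact (ENNReal.ofReal_toReal (measure_ne_top _ _)).symm
  -- Outside `s` the probabilities sum to less than 1, so no infinite product needs to be estimated.
  obtain ⟨s, hs⟩ := ((tendsto_order.1 (ENNReal.tendsto_tsum_compl_atTop_zero hsum')).2 1
    one_pos).exists
  set S : Set (FinSets V) := ↑(s.map (Function.Embedding.subtype _)) with hS
  set m : FinSets V → MeasurableSpace Ω := fun A => MeasurableSpace.comap (X A) inferInstance
  have hind := indep_iSup_of_disjoint (fun A => (hXm A).comap_le) hXi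
    (disjoint_compl_right (a := S))
  set E₁ : Set Ω := ⋂ A ∈ s.map (Function.Embedding.subtype _), X A ⁻¹' {false} with hE₁
  set E₂ : Set Ω := ⋂ A : {A : {A : FinSets V // v ∈ A.1} // A ∉ s}, X A.1.1 ⁻¹' {false} with hE₂
  have hm : ∀ A, MeasurableSet[m A] (X A ⁻¹' {false}) := fun A =>
    ⟨{false}, measurableSet_singleton _, rfl⟩
  have hle : ∀ (S : Set (FinSets V)) A, A ∈ S → m A ≤ ⨆ A ∈ S, m A := fun S A hA =>
    le_iSup₂_of_le A hA le_rfl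
  have hE₁m : MeasurableSet[⨆ A ∈ S, m A] E₁ :=
    Finset.measurableSet_biInter _ fun A hA => hle S A (by simpa [hS] using hA) _ (hm A)
  have hE₂m : MeasurableSet[⨆ A ∈ Sᶜ, m A] E₂ :=
    MeasurableSet.iInter fun A => hle Sᶜ A.1.1 (by
      simp only [hS, Set.mem_compl_iff, Finset.mem_coe, Finset.mem_map]
      rintro ⟨B, hB, hBA⟩
      exact A.2 (by rwa [← Subtype.ext hBA])) _ (hm _)
  have hmul := (Indep_iff _ _ P).1 hind E₁ E₂ hE₁m hE₂m
  have hpos₁ : P E₁ ≠ 0 := by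
    rw [hE₁, hXi.measure_inter_preimage_eq_mul _ fun A _ => measurableSet_singleton _]
    exact Finset.prod_ne_zero_iff.2 fun A _ => (hfalse A).ne'
  have hpos₂ : P E₂ ≠ 0 := by
    intro h0
    have hc : E₂ᶜ = ⋃ A : {A : {A : FinSets V // v ∈ A.1} // A ∉ s}, X A.1.1 ⁻¹' {true} := by
      ext ω; simp [hE₂]
    have h1 : P E₂ᶜ < 1 := by
      rw [hc]
      exact (measure_iUnion_le _).trans_lt hs
    have h2 : (1 : ENNReal) ≤ P E₂ + P E₂ᶜ := by
      rw [← measure_univ (μ := P), ← Set.union_compl_self E₂]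
      exact measure_union_le _ _
    rw [h0, zero_add] at h2
    exact absurd h1 (not_lt.2 h2)
  have hsub : E₁ ∩ E₂ ⊆ {ω | unionProcess X ω v = true}ᶜ := by
    rintro ω ⟨h1, h2⟩ h
    obtain ⟨A, hvA, hA⟩ := unionProcess_eq_true_iff.1 h
    by_cases hAs : (⟨A, hvA⟩ : {A : FinSets V // v ∈ A.1}) ∈ s
    · have := Set.mem_iInter₂.1 h1 A (Finset.mem_map.2 ⟨_, hAs, rfl⟩)
      simp [hA] at this
    · have := Set.mem_iInter.1 h2 ⟨⟨A, hvA⟩, hAs⟩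
      simp [hA] at this
  have hcompl : 0 < P.real {ω | unionProcess X ω v = true}ᶜ := by
    refine ENNReal.toReal_pos (fun h0 => ?_) (measure_ne_top _ _)
    have := measure_mono_null hsub h0
    rw [hmul, mul_eq_zero] at this
    exact this.elim hpos₁ hpos₂
  have hmeas : MeasurableSet {ω | unionProcess X ω v = true} :=
    (measurable_pi_apply v).comp (measurable_unionProcess hXm) (measurableSet_singleton true)
  rw [probReal_compl_eq_one_sub hmeas] at hcompl
  linarith

end UnionProcess

/-! ### Finite-range domination and the upper bound on exponential moments. -/

section FiniteRange

lemma integral_prod_of_disjoint_blocks {ι κ Ω : Type*} [mΩ : MeasurableSpace Ω] {P : Measure Ω}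
    [IsProbabilityMeasure P] {m : ι → MeasurableSpace Ω} (hle : ∀ i, m i ≤ mΩ)
    (hind : iIndep m P) (B : κ → Set ι) (f : κ → Ω → ℝ)
    (hf : ∀ k, Measurable[⨆ i ∈ B k, m i] (f k)) (s : Finset κ)
    (hB : (s : Set κ).PairwiseDisjoint B) :
    ∫ ω, ∏ k ∈ s, f k ω ∂P = ∏ k ∈ s, ∫ ω, f k ω ∂P := by
  classical
  induction s using Finset.induction_on with
  | empty => simp
  | insert a s ha ih =>
    have hdisj : Disjoint (B a) (⋃ k ∈ s, B k) := by
      refine Set.disjoint_iUnion₂_right.2 fun k hk => ?_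
      exact hB (by simp) (by simp [hk]) (fun h => ha (h ▸ hk))
    have hle' : ∀ S : Set ι, ⨆ i ∈ S, m i ≤ mΩ := fun S => iSup₂_le fun i _ => hle i
    have hprod : Measurable[⨆ i ∈ ⋃ k ∈ s, B k, m i] fun ω => ∏ k ∈ s, f k ω := by
      refine Finset.measurable_prod _ fun k hk => (hf k).mono ?_ le_rfl
      exact biSup_mono fun i hi => Set.mem_biUnion hk hi
    have hI : IndepFun (f a) (fun ω => ∏ k ∈ s, f k ω) P := by
      rw [IndepFun_iff_Indep]
      exact indep_of_indep_of_le_left (indep_of_indep_of_le_right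
        (indep_iSup_of_disjoint hle hind hdisj) hprod.comap_le) (hf a).comap_le
    simp_rw [Finset.prod_insert ha]
    rw [hI.integral_fun_mul_eq_mul_integral
      ((hf a).mono (hle' _) le_rfl).aestronglyMeasurable
      (hprod.mono (hle' _) le_rfl).aestronglyMeasurable,
      ih (hB.subset (by simp))]

variable {d : ℕ} {S : Type*} [MeasurableSpace S]

lemma measurePreserving_shift (μ : Measure S) [IsProbabilityMeasure μ] (v : Fin d → ℤ) :
    MeasurePreserving (shift v : ((Fin d → ℤ) → S) → _)
      (Measure.infinitePi fun _ : Fin d → ℤ => μ) (Measure.infinitePi fun _ : Fin d → ℤ => μ) := by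
  have h := Measure.infinitePi_map_piCongrLeft (fun _ : Fin d → ℤ => μ) (Equiv.addRight v)
  have hs : ⇑(MeasurableEquiv.piCongrLeft (fun _ : Fin d → ℤ => S) (Equiv.addRight v)) =
      shift v := by
    funext U x
    obtain ⟨y, rfl⟩ := (Equiv.addRight v).surjective x
    rw [MeasurableEquiv.coe_piCongrLeft, Equiv.piCongrLeft_apply_apply]
    simp [shift]
  rw [← hs]
  exact ⟨MeasurableEquiv.measurable _, h⟩

/-- A function of the configuration in the box of radius `r` becomes, after a shift, a function of
the configuration in the shifted box. -/
lemma measurable_comp_shift {β : Type*} [MeasurableSpace β] {r : ℕ} {h : ((Fin d → ℤ) → S) → β}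
    (hh : Measurable[boxFiltration d S r] h) (v : Fin d → ℤ) :
    Measurable[⨆ x ∈ {x : Fin d → ℤ | ‖x + v‖ ≤ r},
      MeasurableSpace.comap (fun U : (Fin d → ℤ) → S => U x) inferInstance]
      (fun U => h (shift v U)) := by
  refine @Measurable.comp _ _ _ _ (boxFiltration d S r) _ _ _ hh ?_
  rw [measurable_iff_comap_le]
  change MeasurableSpace.comap _ (⨆ _, _) ≤ _
  rw [MeasurableSpace.comap_iSup]
  refine iSup_le fun x => ?_
  rw [MeasurableSpace.comap_comp]
  exact le_iSup₂_of_le (x.1 - v) (by simpa using x.2) le_rfl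

lemma iIndep_comap_eval (μ : Measure S) [IsProbabilityMeasure μ] :
    iIndep (fun x : Fin d → ℤ =>
      MeasurableSpace.comap (fun U : (Fin d → ℤ) → S => U x) inferInstance)
      (Measure.infinitePi fun _ : Fin d → ℤ => μ) :=
  iIndepFun_infinitePi (P := fun _ : Fin d → ℤ => μ) (X := fun _ s => s) fun _ => measurable_id

lemma disjoint_shifted_boxes (r : ℕ) {w w' : Fin d → ℤ} (h : w ≠ w') :
    Disjoint {x : Fin d → ℤ | ‖x + -((2 * r + 1 : ℤ) • w)‖ ≤ r}
      {x : Fin d → ℤ | ‖x + -((2 * r + 1 : ℤ) • w')‖ ≤ r} := by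
  refine Set.disjoint_left.2 fun x hx hx' => h (funext fun i => ?_)
  have key : ∀ u : Fin d → ℤ, ‖x + -((2 * r + 1 : ℤ) • u)‖ ≤ r →
      |x i - (2 * r + 1) * u i| ≤ r := by
    intro u hu
    have h1 := (norm_le_pi_norm (x + -((2 * r + 1 : ℤ) • u)) i).trans hu
    rw [Int.norm_eq_abs] at h1
    have h2 : (|x i - (2 * r + 1) * u i| : ℤ) ≤ (r : ℤ) := by
      have h3 : (x + -((2 * r + 1 : ℤ) • u)) i = x i - (2 * r + 1) * u i := by
        simp [sub_eq_add_neg]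
      rw [h3] at h1
      exact_mod_cast h1
    exact h2
  have h1 := abs_le.1 (key w hx)
  have h2 := abs_le.1 (key w' hx')
  by_contra hne
  rcases lt_or_gt_of_ne hne with hlt | hlt
  · nlinarith
  · nlinarith

/-- For a local function `h`, the values of `h` along translates by the sublattice
`(2r+1)ℤ^d` are independent. -/
lemma integral_exp_sum_shift (μ : Measure S) [IsProbabilityMeasure μ] {r : ℕ}
    {h : ((Fin d → ℤ) → S) → Bool} (hh : Measurable[boxFiltration d S r] h)
    (W : Finset (Fin d → ℤ)) :
    ∫ U, Real.exp (∑ w ∈ W, if h (shift (-((2 * r + 1 : ℤ) • w)) U) = true then 1 else 0)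
        ∂(Measure.infinitePi fun _ : Fin d → ℤ => μ) =
      (1 + (Measure.infinitePi fun _ : Fin d → ℤ => μ).real {U | h U = true} *
        (Real.exp 1 - 1)) ^ W.card := by
  set Q := Measure.infinitePi fun _ : Fin d → ℤ => μ
  set φ : Bool → ℝ := fun b => Real.exp (if b = true then 1 else 0) with hφ
  have hφm : Measurable φ := measurable_of_finite φ
  have hhm : Measurable h := hh.mono ((boxFiltration d S).le r) le_rfl
  simp_rw [Real.exp_sum]
  have h1 := integral_prod_of_disjoint_blocks (P := Q)
    (fun x : Fin d → ℤ => (measurable_pi_apply x).comap_le) (iIndep_comap_eval μ)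
    (fun w : Fin d → ℤ => {x : Fin d → ℤ | ‖x + -((2 * r + 1 : ℤ) • w)‖ ≤ r})
    (fun w U => φ (h (shift (-((2 * r + 1 : ℤ) • w)) U)))
    (fun w => hφm.comp (measurable_comp_shift hh _)) W
    (fun w _ w' _ hne => disjoint_shifted_boxes r hne)
  refine h1.trans ?_
  have h2 : ∀ w : Fin d → ℤ, ∫ U, φ (h (shift (-((2 * r + 1 : ℤ) • w)) U)) ∂Q =
      1 + Q.real {U | h U = true} * (Real.exp 1 - 1) := by
    intro w
    have hE : MeasurableSet {U | h U = true} := hhm (measurableSet_singleton true)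
    have hmp := measurePreserving_shift μ (-((2 * r + 1 : ℤ) • w))
    have h3 : ∫ U, φ (h (shift (-((2 * r + 1 : ℤ) • w)) U)) ∂Q = ∫ U, φ (h U) ∂Q := by
      have h4 := integral_map (μ := Q) hmp.measurable.aemeasurable (f := fun U => φ (h U))
        (hφm.comp hhm).aestronglyMeasurable
      rw [hmp.map_eq] at h4
      exact h4.symm
    have h4 : ∀ U, φ (h U) = 1 + {U | h U = true}.indicator (fun _ => Real.exp 1 - 1) U := by
      intro U
      by_cases hU : h U = true <;> simp [hφ, hU]
    rw [h3]
    simp_rw [h4]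
    rw [integral_add (integrable_const _) ((integrable_const _).indicator hE),
      integral_indicator_const _ hE]
    simp
  simp_rw [h2]
  simp

/-- A binary process that is a finitary factor of an IID process and does not occupy the origin
almost surely is dominated by a finite-range factor of an IID process with the same property. -/
lemma exists_integral_expCount_le {Ω : Type*} [MeasurableSpace Ω] {P : Measure Ω}
    [IsProbabilityMeasure P] {Z : Ω → (Fin d → ℤ) → Bool}
    (hZ : IsFinitaryFactorOfIID.{w} Z P) (hZ0 : P.real {ω | Z ω 0 = true} < 1) :
    ∃ (r : ℕ) (ρ : ℝ), 0 ≤ ρ ∧ ρ < 1 ∧ ∀ W : Finset (Fin d → ℤ),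
      ∫ ω, Real.exp (∑ w ∈ W, if Z ω ((2 * r + 1 : ℤ) • w) = true then 1 else 0) ∂P ≤
        (1 + ρ * (Real.exp 1 - 1)) ^ W.card := by
  obtain ⟨S, _, μ, _, F, hF, hshift, hdist, R, hR, hRfin, g, hg, hFg⟩ := hZ
  set Q := Measure.infinitePi fun _ : Fin d → ℤ => μ
  have hRm' : ∀ r : ℕ, MeasurableSet {U | R U ≤ r} := fun r => (boxFiltration d S).le r _ (hR r)
  have hg0 : Q.real {U | g U = true} < 1 := by
    have h1 : Q {U | g U = true} = P {ω | Z ω 0 = true} := by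
      rw [show P {ω | Z ω 0 = true} = P (Z ⁻¹' {z | z 0 = true}) from rfl,
        hdist.measure_mem_eq (s := {z | z 0 = true})
          (measurable_pi_apply (X := fun _ : Fin d → ℤ => Bool) 0 (measurableSet_singleton true))]
      refine measure_congr ?_
      filter_upwards [hFg] with U hU
      exact propext (by
        change g U = true ↔ F U 0 = true
        rw [hU])
    rw [Measure.real, h1]
    exact hZ0
  have htail : Filter.Tendsto (fun r : ℕ => Q.real {U | R U ≤ r}ᶜ) Filter.atTop (nhds 0) := by
    have h1 : Filter.Tendsto (fun r : ℕ => Q {U | R U ≤ r}ᶜ) Filter.atTop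
        (nhds (Q (⋂ r : ℕ, {U | R U ≤ r}ᶜ))) := by
      refine tendsto_measure_iInter_atTop (fun r => (hRm' r).compl.nullMeasurableSet) ?_
        ⟨0, measure_ne_top _ _⟩
      intro r r' hrr U hU hU'
      have h3 : R U ≤ r := hU'
      exact hU (show R U ≤ r' from h3.trans (by exact_mod_cast hrr))
    have h2 : Q (⋂ r : ℕ, {U | R U ≤ r}ᶜ) = 0 := by
      refine measure_mono_null (fun U hU => ?_) (ae_iff.1 hRfin)
      simp only [ne_eq, not_not]
      by_contra hne
      obtain ⟨r, hr⟩ := WithTop.ne_top_iff_exists.1 hne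
      exact Set.mem_iInter.1 hU r (by simp [← hr])
    rw [h2] at h1
    exact (ENNReal.tendsto_toReal ENNReal.zero_ne_top).comp h1
  -- Truncation adds at most `P(R > r)` to the density; `r` is chosen to keep the total below 1.
  obtain ⟨r, hr⟩ := ((tendsto_order.1 htail).2 _ (sub_pos.2 hg0)).exists
  classical
  -- The default value when `R > r` is `true`, so that `h` dominates `g`. Its zero set `{g = false}
  -- ∩ {R ≤ r}` lies in the box σ-algebra of radius `r` because `g` is measurable at the stopping
  -- time.
  set h : ((Fin d → ℤ) → S) → Bool := fun U => decide (R U ≤ r → g U = true) with hh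
  have hhm : Measurable[boxFiltration d S r] h := by
    refine @measurable_to_bool _ (boxFiltration d S r) _ ?_
    have h1 : h ⁻¹' {true} = (g ⁻¹' {false} ∩ {U | R U ≤ r})ᶜ := by
      ext U
      cases hgU : g U <;> simp [hh, hgU]
    rw [h1]
    exact MeasurableSet.compl ((hg (measurableSet_singleton false)).2 r)
  refine ⟨r, Q.real {U | h U = true}, measureReal_nonneg, ?_, fun W => ?_⟩
  · refine (measureReal_mono (s₂ := {U | g U = true} ∪ {U | R U ≤ r}ᶜ) ?_).trans_lt
      ((measureReal_union_le _ _).trans_lt (by linarith))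
    intro U hU
    have hU' : R U ≤ r → g U = true := of_decide_eq_true hU
    by_cases hRU : R U ≤ r
    · exact Or.inl (hU' hRU)
    · exact Or.inr hRU
  · rw [← integral_exp_sum_shift μ hhm W]
    set a : (Fin d → ℤ) → (Fin d → ℤ) := fun w => (2 * r + 1 : ℤ) • w
    set G : ((Fin d → ℤ) → Bool) → ℝ :=
      fun z => Real.exp (∑ w ∈ W, if z (a w) = true then 1 else 0) with hG
    have hGm : Measurable G := by
      refine Real.measurable_exp.comp (Finset.measurable_sum _ fun w _ => ?_)
      exact Measurable.ite (measurable_pi_apply (X := fun _ : Fin d → ℤ => Bool) (a w)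
        (measurableSet_singleton true)) measurable_const measurable_const
    have h1 : ∫ ω, G (Z ω) ∂P = ∫ U, G (F U) ∂Q := (hdist.comp hGm).integral_eq
    refine h1.trans_le (integral_mono_of_nonneg (ae_of_all _ fun U => (Real.exp_pos _).le) ?_ ?_)
    · refine Integrable.of_bound (C := Real.exp W.card) ?_ (ae_of_all _ fun U => ?_)
      · refine Measurable.aestronglyMeasurable ?_
        refine Real.measurable_exp.comp (Finset.measurable_sum _ fun w _ => ?_)
        refine Measurable.ite ?_ measurable_const measurable_const
        exact ((hhm.mono ((boxFiltration d S).le r) le_rfl).comp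
          (measurePreserving_shift μ _).measurable) (measurableSet_singleton true)
      · rw [Real.norm_of_nonneg (Real.exp_pos _).le]
        refine Real.exp_le_exp.2 ((Finset.sum_le_card_nsmul W _ 1 fun v _ => ?_).trans (by simp))
        split_ifs <;> norm_num
    -- Equivariance moves the site `a w` to the origin, where the coding applies; shift invariance
    -- of `Q` preserves the null set, and `W` is finite.
    · have h2 : ∀ᵐ U ∂Q, ∀ w ∈ W, F U (a w) = g (shift (-(a w)) U) := by
        refine (Filter.eventually_all_finset W).2 fun w _ => ?_
        have h3 := (measurePreserving_shift μ (-(a w))).quasiMeasurePreserving.ae hFg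
        filter_upwards [hshift (-(a w)), h3] with U hU hU'
        rw [← hU', hU]
        simp [shift]
      filter_upwards [h2] with U hU
      refine Real.exp_le_exp.2 (Finset.sum_le_sum fun w hw => ?_)
      rw [hU w hw]
      by_cases hgU : g (shift (-(a w)) U) = true
      · have : h (shift (-(a w)) U) = true := by simp [hh, hgU]
        rw [if_pos hgU, if_pos this]
      · rw [if_neg hgU]
        split_ifs <;> norm_num

end FiniteRange

/-! ### Exponential decay of `sizeSum`. -/

section Tail

variable {d : ℕ}

lemma FinSets.mem_translate {A : FinSets (Fin d → ℤ)} {v x : Fin d → ℤ} :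
    x ∈ (A.translate v).1 ↔ x - v ∈ A.1 := by
  simp only [FinSets.translate, Finset.mem_map, Equiv.coe_toEmbedding, Equiv.coe_addRight]
  exact ⟨by rintro ⟨a, ha, rfl⟩; simpa using ha, fun h => ⟨_, h, by simp⟩⟩

lemma FinSets.card_translate (A : FinSets (Fin d → ℤ)) (v : Fin d → ℤ) :
    (A.translate v).1.card = A.1.card := by
  simp [FinSets.translate]

lemma FinSets.translate_injective (v : Fin d → ℤ) :
    Function.Injective fun A : FinSets (Fin d → ℤ) => A.translate v := by
  intro A B h
  refine Subtype.ext (Finset.ext fun x => ?_)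
  have := congrArg (fun C : FinSets (Fin d → ℤ) => x + v ∈ C.1) h
  simpa [FinSets.mem_translate] using this

/-- The sum of `p_A` over the sets `A` of size `n` that contain the origin. -/
noncomputable def sizeSum (p : FinSets (Fin d → ℤ) → ℝ) (n : ℕ) : ℝ :=
  ∑' A : {A : FinSets (Fin d → ℤ) // (0 : Fin d → ℤ) ∈ A.1}, if A.1.1.card = n then p A.1 else 0

variable {p : FinSets (Fin d → ℤ) → ℝ}

lemma summable_sizeSum (hp0 : ∀ A, 0 ≤ p A)
    (hsum : Summable fun A : {A : FinSets (Fin d → ℤ) // (0 : Fin d → ℤ) ∈ A.1} => p A.1) (n : ℕ) :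
    Summable fun A : {A : FinSets (Fin d → ℤ) // (0 : Fin d → ℤ) ∈ A.1} =>
      if A.1.1.card = n then p A.1 else 0 := by
  refine Summable.of_nonneg_of_le (fun A => ?_) (fun A => ?_) hsum
  · split_ifs
    exacts [hp0 _, le_rfl]
  · split_ifs
    exacts [le_rfl, hp0 _]

lemma sum_le_sizeSum (hp0 : ∀ A, 0 ≤ p A)
    (hsum : Summable fun A : {A : FinSets (Fin d → ℤ) // (0 : Fin d → ℤ) ∈ A.1} => p A.1)
    {n : ℕ} (s : Finset {A : FinSets (Fin d → ℤ) // (0 : Fin d → ℤ) ∈ A.1})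
    (hs : ∀ A ∈ s, A.1.1.card = n) : ∑ A ∈ s, p A.1 ≤ sizeSum p n := by
  refine (Finset.sum_congr rfl fun A hA => ?_).trans_le
    ((summable_sizeSum hp0 hsum n).sum_le_tsum s fun A _ => ?_)
  · rw [if_pos (hs A hA)]
  · split_ifs
    exacts [hp0 _, le_rfl]

lemma sum_mem_le_sizeSum (hp0 : ∀ A, 0 ≤ p A)
    (hsum : Summable fun A : {A : FinSets (Fin d → ℤ) // (0 : Fin d → ℤ) ∈ A.1} => p A.1)
    (hinv : ∀ (A : FinSets (Fin d → ℤ)) (v : Fin d → ℤ), p (A.translate v) = p A)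
    {n : ℕ} (s : Finset (FinSets (Fin d → ℤ))) (hs : ∀ A ∈ s, A.1.card = n) (x : Fin d → ℤ) :
    ∑ A ∈ s with x ∈ A.1, p A ≤ sizeSum p n := by
  classical
  set e : {A // A ∈ s.filter fun A => x ∈ A.1} →
      {A : FinSets (Fin d → ℤ) // (0 : Fin d → ℤ) ∈ A.1} := fun A =>
    ⟨A.1.translate (-x), by
      rw [FinSets.mem_translate]
      simpa using (Finset.mem_filter.1 A.2).2⟩ with he
  have hinj : Function.Injective e := fun A B h =>
    Subtype.ext (FinSets.translate_injective (-x) (congrArg Subtype.val h))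
  refine le_trans (le_of_eq ?_) (sum_le_sizeSum hp0 hsum
    ((s.filter fun A => x ∈ A.1).attach.image e) fun A hA => ?_)
  · rw [Finset.sum_image hinj.injOn, ← Finset.sum_attach]
    exact Finset.sum_congr rfl fun A _ => (hinv _ _).symm
  · obtain ⟨B, -, rfl⟩ := Finset.mem_image.1 hA
    rw [he]
    simp only [FinSets.card_translate]
    exact hs _ (Finset.mem_filter.1 B.2).1

/-- Double counting: sets of size `n` contained in `Λ`. -/
lemma card_mul_sum_le (hp0 : ∀ A, 0 ≤ p A)
    (hsum : Summable fun A : {A : FinSets (Fin d → ℤ) // (0 : Fin d → ℤ) ∈ A.1} => p A.1)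
    (hinv : ∀ (A : FinSets (Fin d → ℤ)) (v : Fin d → ℤ), p (A.translate v) = p A)
    {n : ℕ} (s : Finset (FinSets (Fin d → ℤ))) (hs : ∀ A ∈ s, A.1.card = n)
    (Λ : Finset (Fin d → ℤ)) (hΛ : ∀ A ∈ s, A.1 ⊆ Λ) :
    n * ∑ A ∈ s, p A ≤ Λ.card * sizeSum p n := by
  have h1 : (n : ℝ) * ∑ A ∈ s, p A = ∑ x ∈ Λ, ∑ A ∈ s with x ∈ A.1, p A := by
    simp_rw [Finset.sum_filter]
    rw [Finset.sum_comm, Finset.mul_sum]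
    refine Finset.sum_congr rfl fun A hA => ?_
    rw [← Finset.sum_filter, Finset.filter_mem_eq_inter, Finset.inter_eq_right.2 (hΛ A hA),
      Finset.sum_const, hs A hA, nsmul_eq_mul]
  rw [h1, ← nsmul_eq_mul]
  exact Finset.sum_le_card_nsmul _ _ _ fun x _ => sum_mem_le_sizeSum hp0 hsum hinv s hs x

/-- Each factor satisfies `1 - min 1 x ≤ exp (-x)`: where the minimum is 1 the factor vanishes, so
truncation does no harm. -/
lemma one_sub_exp_le (hp0 : ∀ A, 0 ≤ p A) {K : ℝ} (hK : 0 ≤ K)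
    (s t : Finset (FinSets (Fin d → ℤ))) (hts : t ⊆ s) {L : ℝ} (hL : L ≤ K * ∑ A ∈ t, p A) :
    1 - Real.exp (-L) ≤ 1 - ∏ A ∈ s, (1 - min 1 (K * p A)) := by
  refine sub_le_sub_left ?_ 1
  have h1 : ∏ A ∈ s, (1 - min 1 (K * p A)) ≤ ∏ A ∈ s, Real.exp (-(K * p A)) := by
    refine Finset.prod_le_prod (fun A _ => sub_nonneg.2 (min_le_left _ _)) fun A _ => ?_
    rcases min_cases 1 (K * p A) with h | h
    · rw [h.1, sub_self]; exact (Real.exp_pos _).le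
    · rw [h.1]; linarith [Real.add_one_le_exp (-(K * p A))]
  refine h1.trans ?_
  rw [← Real.exp_sum, Finset.sum_neg_distrib, ← Finset.mul_sum]
  refine Real.exp_le_exp.2 (neg_le_neg (hL.trans (mul_le_mul_of_nonneg_left ?_ hK)))
  exact Finset.sum_le_sum_of_subset_of_nonneg hts fun A _ _ => hp0 A

/-- The box `[a, b)^d`. -/
noncomputable def cube (d : ℕ) (a b : ℤ) : Finset (Fin d → ℤ) := Fintype.piFinset fun _ => Finset.Ico a b

lemma mem_cube {a b : ℤ} {x : Fin d → ℤ} : x ∈ cube d a b ↔ ∀ i, a ≤ x i ∧ x i < b := by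
  simp [cube]

lemma card_cube (a b : ℤ) : (cube d a b).card = (b - a).toNat ^ d := by
  simp [cube]

lemma exists_bound (s : Finset (FinSets (Fin d → ℤ))) :
    ∃ M : ℕ, 1 ≤ M ∧ ∀ A ∈ s, ∀ x ∈ A.1, ∀ i, |x i| ≤ M := by
  have h : ∀ᶠ M : ℕ in Filter.atTop, ∀ A ∈ s, ∀ x ∈ A.1, ∀ i, |x i| ≤ M := by
    refine (Filter.eventually_all_finset s).2 fun A _ =>
      (Filter.eventually_all_finset A.1).2 fun x _ => Filter.eventually_all.2 fun i => ?_
    filter_upwards [Filter.eventually_ge_atTop (x i).natAbs] with M hM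
    exact abs_le.2 ⟨by omega, by omega⟩
  exact ((Filter.eventually_ge_atTop 1).and h).exists

/-- The comparison of exponential moments which bounds the rate of decay of `sizeSum`. -/
lemma tilting_inequality {Ω : Type*} [MeasurableSpace Ω] {P : Measure Ω} [IsProbabilityMeasure P]
    {X : FinSets (Fin d → ℤ) → Ω → Bool} (hXm : ∀ A, Measurable (X A)) (hXi : iIndepFun X P)
    (hp : ∀ A, p A = P.real {ω | X A ω = true})
    (hsum : Summable fun A : {A : FinSets (Fin d → ℤ) // (0 : Fin d → ℤ) ∈ A.1} => p A.1)
    (hinv : ∀ (A : FinSets (Fin d → ℤ)) (v : Fin d → ℤ), p (A.translate v) = p A)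
    {r : ℕ} {β : ℝ} (hupper : ∀ W : Finset (Fin d → ℤ),
      ∫ ω, Real.exp (∑ w ∈ W, if unionProcess X ω ((2 * r + 1 : ℤ) • w) = true then 1 else 0) ∂P ≤
        Real.exp β ^ W.card)
    {L : ℝ} {n : ℕ} (hn : 0 < sizeSum p n) (hL : sizeSum p n ≤ 2 * L) :
    n * (1 - Real.exp (-L) - β) ≤ 2 * L * (2 * r + 3) ^ d * Real.log (2 * L / sizeSum p n) := by
  classical
  have hp0 : ∀ A, 0 ≤ p A := fun A => by rw [hp]; exact measureReal_nonneg
  set D := sizeSum p n with hD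
  -- The factor 2 compensates for the finite family `B` below, which captures only more than half of
  -- `D`: `K * (D / 2) = L`.
  set K := 2 * L / D with hK
  have hK1 : 1 ≤ K := (one_le_div hn).2 hL
  have hK0 : 0 < K := one_pos.trans_le hK1
  have hlog : 0 ≤ Real.log K := Real.log_nonneg hK1
  have hKD : K * D = 2 * L := div_mul_cancel₀ _ hn.ne'
  obtain ⟨b, hb⟩ : ∃ b : Finset {A : FinSets (Fin d → ℤ) // (0 : Fin d → ℤ) ∈ A.1},
      D / 2 < ∑ A ∈ b, if A.1.1.card = n then p A.1 else 0 :=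
    (((summable_sizeSum hp0 hsum n).hasSum.eventually (lt_mem_nhds (half_lt_self hn)))).exists
  rw [← Finset.sum_filter] at hb
  set B : Finset (FinSets (Fin d → ℤ)) :=
    (b.filter fun A => A.1.1.card = n).map (Function.Embedding.subtype _) with hB
  have hBsum : D / 2 < ∑ A ∈ B, p A := by
    rw [hB, Finset.sum_map]
    exact hb
  have hBmem : ∀ A ∈ B, (0 : Fin d → ℤ) ∈ A.1 ∧ A.1.card = n := by
    intro A hA
    obtain ⟨A', hA', rfl⟩ := Finset.mem_map.1 hA
    exact ⟨A'.2, (Finset.mem_filter.1 hA').2⟩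
  -- `M` serves both as a bound for the sets in `B` and as the side of the index box `W`. All
  -- translates then fit in a cube of side `(2r+3)M`, whose volume is `(2r+3)^d` times `|W|`.
  obtain ⟨M, hM1, hM⟩ := exists_bound B
  set W := cube d 0 M with hW
  have hWcard : W.card = M ^ d := by simp [hW, card_cube]
  set a : (Fin d → ℤ) → (Fin d → ℤ) := fun w => (2 * r + 1 : ℤ) • w with ha
  have hainj : Function.Injective a := smul_right_injective _ (by omega)
  set s : Finset (FinSets (Fin d → ℤ)) :=
    (W ×ˢ B).image fun wA => wA.2.translate (a wA.1) with hs
  have hscard : ∀ A ∈ s, A.1.card = n := by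
    intro A hA
    obtain ⟨⟨w, A'⟩, hA', rfl⟩ := Finset.mem_image.1 hA
    rw [FinSets.card_translate]
    exact (hBmem _ (Finset.mem_product.1 hA').2).2
  have hssub : ∀ A ∈ s, A.1 ⊆ cube d (-M) ((2 * r + 2) * M) := by
    intro A hA x hx
    obtain ⟨⟨w, A'⟩, hA', rfl⟩ := Finset.mem_image.1 hA
    obtain ⟨hw, hA''⟩ := Finset.mem_product.1 hA'
    refine mem_cube.2 fun i => ?_
    have h1 := abs_le.1 (hM A' hA'' _ (FinSets.mem_translate.1 hx) i)
    have h2 := mem_cube.1 hw i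
    simp only [ha, Pi.sub_apply, Pi.smul_apply, smul_eq_mul] at h1 h2
    have hr : (0 : ℤ) ≤ r := Int.natCast_nonneg r
    constructor <;> nlinarith
  -- The gain of a factor `n` comes from here: the expected number of tilted sets, times their size,
  -- is at most of the order of the volume.
  have hcost : n * ∑ A ∈ s, min 1 (K * p A) ≤ M ^ d * (2 * L * (2 * r + 3) ^ d) := by
    have h1 := card_mul_sum_le hp0 hsum hinv s hscard _ hssub
    have h2 : ∑ A ∈ s, min 1 (K * p A) ≤ K * ∑ A ∈ s, p A := by
      rw [Finset.mul_sum]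
      exact Finset.sum_le_sum fun A _ => min_le_right _ _
    have h3 : ((cube d (-M) ((2 * r + 2) * M)).card : ℝ) = M ^ d * (2 * r + 3) ^ d := by
      have : ((2 * r + 2) * M - -M : ℤ).toNat = M * (2 * r + 3) := by
        have : ((2 * r + 2) * M - -M : ℤ) = ((M * (2 * r + 3) : ℕ) : ℤ) := by push_cast; ring
        rw [this, Int.toNat_natCast]
      rw [card_cube, this, mul_pow]
      push_cast
      ring
    rw [h3] at h1
    calc (n : ℝ) * ∑ A ∈ s, min 1 (K * p A) ≤ n * (K * ∑ A ∈ s, p A) :=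
          mul_le_mul_of_nonneg_left h2 (Nat.cast_nonneg n)
      _ = K * (n * ∑ A ∈ s, p A) := by ring
      _ ≤ K * (M ^ d * (2 * r + 3) ^ d * D) := mul_le_mul_of_nonneg_left h1 hK0.le
      _ = M ^ d * ((K * D) * (2 * r + 3) ^ d) := by ring
      _ = _ := by rw [hKD]
  have hcover : ∀ v ∈ W.image a,
      1 - Real.exp (-L) ≤ 1 - ∏ A ∈ s with v ∈ A.1, (1 - min 1 (K * p A)) := by
    intro v hv
    obtain ⟨w, hw, rfl⟩ := Finset.mem_image.1 hv
    refine one_sub_exp_le hp0 hK0.le _ (B.image fun A => A.translate (a w)) ?_ ?_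
    · intro A hA
      obtain ⟨A', hA', rfl⟩ := Finset.mem_image.1 hA
      refine Finset.mem_filter.2 ⟨Finset.mem_image.2 ⟨(w, A'), Finset.mk_mem_product hw hA', rfl⟩, ?_⟩
      rw [FinSets.mem_translate, sub_self]
      exact (hBmem A' hA').1
    · rw [Finset.sum_image (FinSets.translate_injective _).injOn]
      simp_rw [hinv]
      nlinarith
  have hlower := exp_le_integral_expCount hXm hXi (q := fun A => min 1 (K * p A)) hp
    (κ := Real.log K) (s := s)
    (fun A _ => le_min (by rw [hp]; exact measureReal_le_one)
      (le_mul_of_one_le_left (hp0 A) hK1))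
    (fun A _ => min_le_left _ _) (fun A _ => by rw [Real.exp_log hK0]; exact min_le_right _ _)
    (W.image a)
  have hup := hupper W
  have hexp : ∀ ω, expCount (W.image a) (unionProcess X ω) =
      Real.exp (∑ w ∈ W, if unionProcess X ω ((2 * r + 1 : ℤ) • w) = true then 1 else 0) := by
    intro ω
    rw [expCount, Finset.sum_image hainj.injOn]
  simp_rw [hexp] at hlower
  have hle := hlower.trans hup
  rw [← Real.exp_nat_mul, Real.exp_le_exp, hWcard] at hle
  have hsumcover := Finset.card_nsmul_le_sum _ _ _ hcover
  rw [Finset.card_image_of_injective _ hainj, hWcard, nsmul_eq_mul] at hsumcover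
  push_cast at hle hsumcover
  have hMpos : (0 : ℝ) < (M : ℝ) ^ d := by positivity
  have hfin : (M : ℝ) ^ d * (1 - Real.exp (-L) - β) ≤
      Real.log K * ∑ A ∈ s, min 1 (K * p A) := by linarith
  refine le_of_mul_le_mul_left ?_ hMpos
  calc (M : ℝ) ^ d * (n * (1 - Real.exp (-L) - β))
      = n * ((M : ℝ) ^ d * (1 - Real.exp (-L) - β)) := by ring
    _ ≤ n * (Real.log K * ∑ A ∈ s, min 1 (K * p A)) :=
        mul_le_mul_of_nonneg_left hfin (Nat.cast_nonneg n)
    _ = Real.log K * (n * ∑ A ∈ s, min 1 (K * p A)) := by ring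
    _ ≤ Real.log K * (M ^ d * (2 * L * (2 * r + 3) ^ d)) := mul_le_mul_of_nonneg_left hcost hlog
    _ = _ := by ring

/-- Grouping the sets by cardinality leaves a geometric series of ratio `exp (-(c - lam))`. -/
lemma summable_mul_exp_of_sizeSum_le (hp0 : ∀ A, 0 ≤ p A)
    (hsum : Summable fun A : {A : FinSets (Fin d → ℤ) // (0 : Fin d → ℤ) ∈ A.1} => p A.1)
    {C c lam : ℝ} (hc : lam < c) (h : ∀ n : ℕ, sizeSum p n ≤ C * Real.exp (-(c * n))) :
    Summable fun A : {A : FinSets (Fin d → ℤ) // (0 : Fin d → ℤ) ∈ A.1} =>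
      p A.1 * Real.exp (lam * (A.1.1.card : ℝ)) := by
  have hC : 0 ≤ C := by
    have h0 : 0 ≤ sizeSum p 0 := tsum_nonneg fun A => by
      split_ifs
      exacts [hp0 _, le_rfl]
    simpa using h0.trans (h 0)
  have hgeom : Summable fun n : ℕ => C * Real.exp (-(c - lam)) ^ n :=
    (summable_geometric_of_lt_one (Real.exp_pos _).le
      (Real.exp_lt_one_iff.2 (by linarith))).mul_left C
  refine summable_of_sum_le (c := ∑' n : ℕ, C * Real.exp (-(c - lam)) ^ n)
    (fun A => mul_nonneg (hp0 _) (Real.exp_pos _).le) fun s => ?_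
  classical
  rw [← Finset.sum_fiberwise_of_maps_to (t := s.image fun A => A.1.1.card)
    (g := fun A => A.1.1.card) fun A hA => Finset.mem_image_of_mem _ hA]
  refine (Finset.sum_le_sum fun n _ => ?_).trans (hgeom.sum_le_tsum _ fun n _ => by positivity)
  calc ∑ A ∈ s with A.1.1.card = n, p A.1 * Real.exp (lam * (A.1.1.card : ℝ))
      = (∑ A ∈ s with A.1.1.card = n, p A.1) * Real.exp (lam * n) := by
        rw [Finset.sum_mul]
        refine Finset.sum_congr rfl fun A hA => ?_
        rw [(Finset.mem_filter.1 hA).2]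
    _ ≤ C * Real.exp (-(c * n)) * Real.exp (lam * n) :=
        mul_le_mul_of_nonneg_right ((sum_le_sizeSum hp0 hsum _ fun A hA =>
          (Finset.mem_filter.1 hA).2).trans (h n)) (Real.exp_pos _).le
    _ = C * Real.exp (-(c - lam)) ^ n := by
        rw [mul_assoc, ← Real.exp_add, ← Real.exp_nat_mul]
        congr 2
        ring

end Tail

/-! ### Choice of constants and conclusion. -/

theorem theorem1p2 (d : ℕ) (hd : 1 ≤ d)
    {Ω : Type u} [MeasurableSpace Ω] (P : Measure Ω) [IsProbabilityMeasure P]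
    -- independent Bernoulli random variables `X_A` with `p_A = P(X_A = 1)`
    (X : FinSets (Fin d → ℤ) → Ω → Bool) (hXm : ∀ A, Measurable (X A)) (hXi : iIndepFun X P)
    (p : FinSets (Fin d → ℤ) → ℝ) (hp : ∀ A, p A = P.real {ω | X A ω = true})
    (hp1 : ∀ A, p A < 1)
    (hsum : ∀ v : Fin d → ℤ, Summable fun A : {A : FinSets (Fin d → ℤ) // v ∈ A.1} => p A.1)
    -- translation invariance
    (hinv : ∀ (A : FinSets (Fin d → ℤ)) (v : Fin d → ℤ), p (A.translate v) = p A)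
    (hff : IsFinitaryFactorOfIID.{w} (unionProcess X) P) :
    ∃ lam : ℝ, 0 < lam ∧
      Summable fun A : {A : FinSets (Fin d → ℤ) // (0 : Fin d → ℤ) ∈ A.1} =>
        p A.1 * Real.exp (lam * (A.1.1.card : ℝ)) := by
  have hp0 : ∀ A, 0 ≤ p A := fun A => by rw [hp]; exact measureReal_nonneg
  have hdens : P.real {ω | unionProcess X ω 0 = true} < 1 :=
    measureReal_unionProcess_lt_one hXm hXi (fun A => hp A ▸ hp1 A) 0
      ((hsum 0).congr fun A => hp A.1)
  obtain ⟨r, ρ, hρ0, hρ1, hupper⟩ := exists_integral_expCount_le hff hdens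
  have he : 1 < Real.exp 1 := Real.one_lt_exp_iff.2 one_pos
  have hpos : 0 < 1 + ρ * (Real.exp 1 - 1) := by nlinarith
  set β := Real.log (1 + ρ * (Real.exp 1 - 1)) with hβ
  -- Equivalent to `1 + ρ(e - 1) < e`, which is `ρ < 1`.
  have hβ1 : β < 1 := by
    rw [hβ, Real.log_lt_iff_lt_exp hpos]
    nlinarith
  have hupper' : ∀ W : Finset (Fin d → ℤ),
      ∫ ω, Real.exp (∑ w ∈ W, if unionProcess X ω ((2 * r + 1 : ℤ) • w) = true then 1 else 0) ∂P ≤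
        Real.exp β ^ W.card := by
    rw [hβ, Real.exp_log hpos]
    exact hupper
  -- Bounding the total mass by `L` makes `K ≥ 1` for every `n` with `sizeSum p n > 0`; the last
  -- condition makes the coverage `1 - exp (-L)` exceed `β`.
  obtain ⟨L, hL1, hL2, hL3⟩ : ∃ L : ℝ, 0 < L ∧
      (∑' A : {A : FinSets (Fin d → ℤ) // (0 : Fin d → ℤ) ∈ A.1}, p A.1) ≤ L ∧
      Real.exp (-L) < 1 - β :=
    ((Filter.eventually_gt_atTop 0).and ((Filter.eventually_ge_atTop _).and
      (Real.tendsto_exp_neg_atTop_nhds_zero.eventually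
        (gt_mem_nhds (sub_pos.2 hβ1))))).exists
  set C := 2 * L * (2 * r + 3 : ℝ) ^ d with hC
  have hC0 : 0 < C := by positivity
  set c := (1 - Real.exp (-L) - β) / C with hcdef
  have hc0 : 0 < c := div_pos (by linarith) hC0
  refine ⟨c / 2, by positivity, summable_mul_exp_of_sizeSum_le hp0 (hsum 0)
    (half_lt_self hc0) (C := 2 * L) fun n => ?_⟩
  -- Tilting needs some set of size `n` to have positive probability; otherwise the bound is
  -- trivial.
  rcases le_or_gt (sizeSum p n) 0 with hn | hn
  · exact hn.trans (by positivity)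
  · have hle : sizeSum p n ≤ 2 * L := by
      refine (((summable_sizeSum hp0 (hsum 0) n).tsum_le_tsum (fun A => ?_) (hsum 0)).trans
        hL2).trans (by linarith)
      split_ifs
      exacts [le_rfl, hp0 _]
    have h := tilting_inequality hXm hXi hp (hsum 0) hinv hupper' hn hle
    rw [← hC] at h
    have h2 : c * n ≤ Real.log (2 * L / sizeSum p n) := by
      rw [hcdef, div_mul_eq_mul_div, div_le_iff₀ hC0]
      linarith
    rw [Real.le_log_iff_exp_le (by positivity), le_div_iff₀ hn] at h2
    rw [Real.exp_neg, ← div_eq_mul_inv, le_div_iff₀ (Real.exp_pos _)]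
    linarith
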